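/- Let $\psi:[0,\infty)\to[0,\infty)$ be an Orlicz function, i.e. $\psi$ is increasing and convex with $\psi(0)=0$ and $\psi(x)\to\infty$ as $x\to\infty$, and suppose that $\psi$ is continuously differentiable on $[0,\infty)$ (one-sidedly at $0$). For a random variable $X$ with values in a real Banach space with norm $|\cdot|$, let $$\sigma_\psi=\|X\|_\psi=\inf\left\{\sigma>0 \,:\, \mathbb{E}\,\psi\left(\tfrac{|X|}{\sigma}\right)\le 1\right\},$$ and for i.i.d. random variables $X_1,X_2,\ldots$ with the same distribution as $X$ let $$\widehat\sigma_\psi=\widehat\sigma_\psi(X_1,\ldots,X_n)=\inf\left\{\sigma>0 \,:\, \frac1n\sum_{i=1}^n \psi\left(\tfrac{|X_i|}{\sigma}\right)\le 1\right\}$$ be the empirical Orlicz norm. Assume $\sigma_\psi<\infty$. (a) Suppose that (i) $\mathbb{E}\,\psi(|X|/\sigma_\psi)^2<\infty$ and (ii) $\mathbb{E}\,|X|\,\psi'(|X|/\sigma)<\infty$ for some $0<\sigma<\sigma_\psi$. Then $\mathbb{E}\,\psi(|X|/\sigma_\psi)^2\ge 1$, $0<\mathbb{E}\left[\frac{|X|}{\sigma_\psi^2}\psi'\left(\frac{|X|}{\sigma_\psi}\right)\right]<\infty$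 and, as $n\to\infty$, $$\sqrt n\,(\widehat\sigma_\psi-\sigma_\psi)\overset{d}{\longrightarrow}\mathcal N\left(0,\ \frac{\mathbb{E}\,\psi\left(\frac{|X|}{\sigma_\psi}\right)^2-1}{\left[\mathbb{E}\,\frac{|X|}{\sigma_\psi^2}\,\psi'\left(\frac{|X|}{\sigma_\psi}\right)\right]^2}\right),$$ where $\mathcal N(0,0)$ denotes the point mass at $0$. (b) If $\mathbb{E}\,\psi\left(\frac{|X|}{\sigma}+1\right)^2<\infty$ for some $0<\sigma<\sigma_\psi$, then (i) and (ii) hold. -/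

import Mathlib

open MeasureTheory ProbabilityTheory Filter Set
open scoped Topology

/-- `ψ` (only its values on `[0, ∞)` matter) is an Orlicz function `[0, ∞) → [0, ∞)`:
increasing (in the weak sense), convex, `ψ 0 = 0` and `ψ x → ∞` as `x → ∞`.
Nonnegativity on `[0, ∞)` follows from `map_zero` and `monotoneOn`. -/
structure IsOrliczFunction (ψ : ℝ → ℝ) : Prop where
  monotoneOn : MonotoneOn ψ (Ici 0)
  convexOn : ConvexOn ℝ (Ici 0) ψ
  map_zero : ψ 0 = 0
  tendsto_atTop : Tendsto ψ atTop atTop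

/-- The Orlicz norm `inf {σ > 0 | E ψ(‖X‖ / σ) ≤ 1}`. The expectation of the nonnegative variable
is taken in `[0, ∞]`, so that an infinite expectation does not satisfy the constraint.
If no `σ` is admissible (infinite Orlicz norm), the real infimum takes the value `0`. -/
noncomputable def orliczNorm {Ω E : Type*} [MeasurableSpace Ω] [NormedAddCommGroup E]
    (ψ : ℝ → ℝ) (X : Ω → E) (P : Measure Ω) : ℝ :=
  sInf {σ : ℝ | 0 < σ ∧ ∫⁻ ω, ENNReal.ofReal (ψ (‖X ω‖ / σ)) ∂P ≤ 1}

/-- The empirical Orlicz norm `inf {σ > 0 | (1/n) ∑ ψ(‖xᵢ‖ / σ) ≤ 1}` of a sample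
`x₁, …, xₙ`. -/
noncomputable def empiricalOrliczNorm {E : Type*} [NormedAddCommGroup E]
    (ψ : ℝ → ℝ) {n : ℕ} (x : Fin n → E) : ℝ :=
  sInf {σ : ℝ | 0 < σ ∧ (1 / (n : ℝ)) * ∑ i, ψ (‖x i‖ / σ) ≤ 1}

/-! In the variable `u = 1 / σ`, the mean `h u = E ψ(‖X‖ u)` and the sample averages `h_n u` are
convex and nondecreasing, and vanish at `0`; the two norms are reciprocals of the points where these
functions reach level `1`. Fix `u = 1 / σ_ψ` and let `v_n` be the reciprocal of the empirical norm.
From `h_n v_n = 1` one gets the exact identity `1 / v_n - 1 / u = (h_n u - 1) / (u v_n S_n)`, with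
`S_n` the secant slope of `h_n` between `u` and `v_n`. Convexity traps `S_n` between secants ending
at fixed points `u ± δ k`, so the law of large numbers at countably many points gives `S_n → h' u`
almost surely; no uniform law is needed (`tendsto_secant_of_convexOn`, `tendsto_levelInv_ratio`).
The central limit theorem for `h_n u - 1` and Slutsky's lemma finish the proof. Condition (ii)
permits differentiation under the expectation and yields `h u = 1`; condition (i) is the finite
variance. -/

/-! ### Level points of convex functions. -/

/-- Nondecreasing continuous convex functions on `[0, ∞)` vanishing at `0`. -/
structure IsConvexGrowth (h : ℝ → ℝ) : Prop where
  monotoneOn : MonotoneOn h (Ici 0)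
  convexOn : ConvexOn ℝ (Ici 0) h
  continuousOn : ContinuousOn h (Ici 0)
  map_zero : h 0 = 0

/-- The reciprocal of the level `1` of `h`, as an infimum. -/
noncomputable def levelInv (h : ℝ → ℝ) : ℝ := sInf {σ : ℝ | 0 < σ ∧ h σ⁻¹ ≤ 1}

lemma levelInv_nonneg (h : ℝ → ℝ) : 0 ≤ levelInv h :=
  Real.sInf_nonneg fun _ hx => hx.1.le

namespace IsConvexGrowth

variable {h : ℝ → ℝ}

/-- Convexity on the chord from the origin: `h x / x` is nondecreasing. -/
lemma mul_le (hh : IsConvexGrowth h) {x y : ℝ} (hx : 0 ≤ x) (hxy : x ≤ y) :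
    y * h x ≤ x * h y := by
  rcases hx.eq_or_lt with rfl | hx
  · simp [hh.map_zero]
  have hy : 0 < y := hx.trans_le hxy
  have hq : 0 ≤ 1 - x / y := sub_nonneg.2 ((div_le_one hy).2 hxy)
  have := hh.convexOn.2 (mem_Ici.2 le_rfl) (mem_Ici.2 hy.le) hq (div_nonneg hx.le hy.le) (by ring)
  simp only [smul_eq_mul, mul_zero, zero_add, hh.map_zero, div_mul_cancel₀ _ hy.ne'] at this
  calc y * h x ≤ y * (x / y * h y) := by gcongr
    _ = x * h y := by field_simp

lemma continuousAt (hh : IsConvexGrowth h) {x : ℝ} (hx : 0 < x) : ContinuousAt h x :=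
  hh.continuousOn.continuousAt (Ici_mem_nhds hx)

lemma continuousAt_inv (hh : IsConvexGrowth h) {s : ℝ} (hs : 0 < s) :
    ContinuousAt (fun σ => h σ⁻¹) s :=
  ContinuousAt.comp (f := fun σ : ℝ => σ⁻¹) (g := h) (hh.continuousAt (inv_pos.2 hs))
    (continuousAt_inv₀ hs.ne')

lemma nonempty_admissible (hh : IsConvexGrowth h) :
    {σ : ℝ | 0 < σ ∧ h σ⁻¹ ≤ 1}.Nonempty := by
  have h1 : Tendsto h (𝓝[≥] 0) (𝓝 0) := by
    simpa [ContinuousWithinAt, hh.map_zero] using hh.continuousOn 0 (mem_Ici.2 le_rfl)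
  have h2 : Tendsto (fun σ : ℝ => σ⁻¹) atTop (𝓝[≥] 0) :=
    tendsto_inv_atTop_nhdsGT_zero.mono_right (nhdsWithin_mono _ Ioi_subset_Ici_self)
  obtain ⟨σ, hσ⟩ := (((h1.comp h2).eventually (ge_mem_nhds one_pos)).and
    (eventually_gt_atTop 0)).exists
  exact ⟨σ, hσ.2, hσ.1⟩

/-- By continuity the infimum, when positive, is attained, so the equivalence also holds at the
infimum itself. -/
lemma levelInv_le_iff (hh : IsConvexGrowth h) {s : ℝ} (hs : 0 < s) :
    levelInv h ≤ s ↔ h s⁻¹ ≤ 1 := by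
  constructor
  · intro hle
    have ev : ∀ᶠ σ in 𝓝[>] s, h σ⁻¹ ≤ 1 := by
      filter_upwards [self_mem_nhdsWithin] with σ hσ
      obtain ⟨τ, ⟨hτ, hτ1⟩, hτσ⟩ :=
        exists_lt_of_csInf_lt hh.nonempty_admissible (hle.trans_lt (mem_Ioi.1 hσ))
      refine (hh.monotoneOn ?_ ?_ ?_).trans hτ1
      · exact mem_Ici.2 (inv_nonneg.2 (hτ.trans hτσ).le)
      · exact mem_Ici.2 (inv_nonneg.2 hτ.le)
      · exact inv_anti₀ hτ hτσ.le
    exact le_of_tendsto ((hh.continuousAt_inv hs).mono_left nhdsWithin_le_nhds) ev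
  · intro hle
    exact csInf_le ⟨0, fun _ hx => hx.1.le⟩ ⟨hs, hle⟩

lemma lt_levelInv_iff (hh : IsConvexGrowth h) {s : ℝ} (hs : 0 < s) :
    s < levelInv h ↔ 1 < h s⁻¹ := by
  rw [← not_le, hh.levelInv_le_iff hs, not_le]

lemma apply_inv_levelInv (hh : IsConvexGrowth h) (hpos : 0 < levelInv h) :
    h (levelInv h)⁻¹ = 1 := by
  refine le_antisymm ((hh.levelInv_le_iff hpos).1 le_rfl) ?_
  have ev : ∀ᶠ σ in 𝓝[<] levelInv h, 1 ≤ h σ⁻¹ := by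
    filter_upwards [Ioo_mem_nhdsLT hpos] with σ hσ
    exact ((hh.lt_levelInv_iff hσ.1).1 hσ.2).le
  exact ge_of_tendsto ((hh.continuousAt_inv hpos).mono_left nhdsWithin_le_nhds) ev

lemma levelInv_eq (hh : IsConvexGrowth h) {u : ℝ} (hu : 0 < u) (h1 : h u = 1) :
    levelInv h = u⁻¹ := by
  refine le_antisymm ((hh.levelInv_le_iff (inv_pos.2 hu)).2 (by simp [h1])) ?_
  refine le_of_forall_lt_imp_le_of_dense fun s hs => ?_
  rcases le_or_gt s 0 with h0 | h0
  · exact h0.trans (levelInv_nonneg h)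
  refine ((hh.lt_levelInv_iff h0).2 ?_).le
  have hus : u < s⁻¹ := (lt_inv_comm₀ h0 hu).1 hs
  have := hh.mul_le hu.le hus.le
  rw [h1] at this
  by_contra! hle
  nlinarith

end IsConvexGrowth

/-! ### Stability and linearization of the level point. -/

/-- Convergence at the single point `u` suffices: `mul_le` turns a value near `1` at `u` into a
strict crossing of level `1` on either side of `u`. -/
lemma tendsto_levelInv {hs : ℕ → ℝ → ℝ} (hconv : ∀ n, IsConvexGrowth (hs n)) {u : ℝ} (hu : 0 < u)
    (hlim : Tendsto (fun n => hs n u) atTop (𝓝 1)) :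
    Tendsto (fun n => levelInv (hs n)) atTop (𝓝 u⁻¹) := by
  have hu' := inv_pos.2 hu
  rw [tendsto_order]
  constructor
  · intro a ha
    obtain ⟨b, hb, hbu⟩ := exists_between (max_lt ha hu')
    have hb0 : 0 < b := (le_max_right _ _).trans_lt hb
    have hub : u < b⁻¹ := (lt_inv_comm₀ hb0 hu).1 hbu
    have : Tendsto (fun n => b⁻¹ * hs n u) atTop (𝓝 b⁻¹) := by simpa using hlim.const_mul b⁻¹
    filter_upwards [this.eventually (lt_mem_nhds hub)] with n hn
    refine ((le_max_left _ _).trans_lt hb).trans (((hconv n).lt_levelInv_iff hb0).2 ?_)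
    have := (hconv n).mul_le hu.le hub.le
    by_contra! hle
    nlinarith
  · intro a ha
    obtain ⟨b, hbu, hb⟩ := exists_between ha
    have hb0 : 0 < b := hu'.trans hbu
    have hub : b⁻¹ < u := (inv_lt_comm₀ hu hb0).1 hbu
    have : Tendsto (fun n => b⁻¹ * hs n u) atTop (𝓝 b⁻¹) := by simpa using hlim.const_mul b⁻¹
    filter_upwards [this.eventually (gt_mem_nhds hub)] with n hn
    refine lt_of_le_of_lt (((hconv n).levelInv_le_iff hb0).2 ?_) hb
    have := (hconv n).mul_le (inv_pos.2 hb0).le hub.le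
    by_contra! hle
    nlinarith

/-- Secant slopes at `u` along points converging to `u` approach the derivative of the pointwise
limit of convex functions; coincident points are given the derivative itself. -/
lemma tendsto_secant_of_convexOn {hs : ℕ → ℝ → ℝ} {h : ℝ → ℝ}
    (hconv : ∀ n, ConvexOn ℝ (Ici 0) (hs n)) {u D : ℝ} (hu : 0 < u) (hD : HasDerivAt h D u)
    {δ : ℕ → ℝ} (hδ0 : ∀ k, 0 < δ k) (hδu : ∀ k, δ k < u) (hδ : Tendsto δ atTop (𝓝 0))
    (hlim : Tendsto (fun n => hs n u) atTop (𝓝 (h u)))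
    (hlim_add : ∀ k, Tendsto (fun n => hs n (u + δ k)) atTop (𝓝 (h (u + δ k))))
    (hlim_sub : ∀ k, Tendsto (fun n => hs n (u - δ k)) atTop (𝓝 (h (u - δ k))))
    {v : ℕ → ℝ} (hv : Tendsto v atTop (𝓝 u)) :
    Tendsto (fun n => if v n = u then D else slope (hs n) u (v n)) atTop (𝓝 D) := by
  have hslope := hasDerivAt_iff_tendsto_slope.1 hD
  have hadd : Tendsto (fun k => slope h u (u + δ k)) atTop (𝓝 D) := by
    refine hslope.comp (tendsto_nhdsWithin_iff.2 ⟨by simpa using hδ.const_add u, ?_⟩)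
    exact .of_forall fun k => by simp [(hδ0 k).ne']
  have hsub : Tendsto (fun k => slope h u (u - δ k)) atTop (𝓝 D) := by
    refine hslope.comp (tendsto_nhdsWithin_iff.2 ⟨by simpa using hδ.const_sub u, ?_⟩)
    exact .of_forall fun k => by simp [(hδ0 k).ne']
  have hslope_lim {w : ℝ} (hw : Tendsto (fun n => hs n w) atTop (𝓝 (h w))) :
      Tendsto (fun n => slope (hs n) u w) atTop (𝓝 (slope h u w)) := by
    simp only [slope_def_field]
    exact (hw.sub hlim).div_const _
  -- Each bound on `D` is met by one fixed secant ending at `u ± δ k`; since slopes are monotone, it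
  -- controls the secant to `v n` as soon as `v n` is past `u - δ k`, respectively before `u + δ k`.
  rw [tendsto_order]
  constructor
  · intro a ha
    obtain ⟨k, hk⟩ := (hsub.eventually (lt_mem_nhds ha)).exists
    filter_upwards [(hslope_lim (hlim_sub k)).eventually (lt_mem_nhds hk),
      hv.eventually (lt_mem_nhds (sub_lt_self u (hδ0 k)))] with n hn hvn
    split_ifs with hvu
    · exact ha
    · refine hn.trans_le ((hconv n).slope_mono (mem_Ici.2 hu.le) ?_ ?_ hvn.le)
      · exact ⟨mem_Ici.2 (sub_nonneg.2 (hδu k).le), by simp [(hδ0 k).ne']⟩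
      · exact ⟨mem_Ici.2 ((sub_nonneg.2 (hδu k).le).trans hvn.le), hvu⟩
  · intro a ha
    obtain ⟨k, hk⟩ := (hadd.eventually (gt_mem_nhds ha)).exists
    filter_upwards [(hslope_lim (hlim_add k)).eventually (gt_mem_nhds hk),
      hv.eventually (gt_mem_nhds (lt_add_of_pos_right u (hδ0 k))),
      hv.eventually (lt_mem_nhds hu)] with n hn hvn hvn0
    split_ifs with hvu
    · exact ha
    · refine ((hconv n).slope_mono (mem_Ici.2 hu.le) ?_ ?_ hvn.le).trans_lt hn
      · exact ⟨mem_Ici.2 hvn0.le, hvu⟩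
      · exact ⟨mem_Ici.2 (add_pos hu (hδ0 k)).le, by simp [(hδ0 k).ne']⟩

/-- The error of `levelInv` is asymptotically linear in the error of the function at the level. -/
lemma tendsto_levelInv_ratio {hs : ℕ → ℝ → ℝ} {h : ℝ → ℝ}
    (hconv : ∀ n, IsConvexGrowth (hs n)) {u D : ℝ} (hu : 0 < u) (hD0 : D ≠ 0)
    (hD : HasDerivAt h D u) (h1 : h u = 1)
    {δ : ℕ → ℝ} (hδ0 : ∀ k, 0 < δ k) (hδu : ∀ k, δ k < u) (hδ : Tendsto δ atTop (𝓝 0))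
    (hlim : Tendsto (fun n => hs n u) atTop (𝓝 (h u)))
    (hlim_add : ∀ k, Tendsto (fun n => hs n (u + δ k)) atTop (𝓝 (h (u + δ k))))
    (hlim_sub : ∀ k, Tendsto (fun n => hs n (u - δ k)) atTop (𝓝 (h (u - δ k)))) :
    Tendsto (fun n => if hs n u = 1 then (u * u * D)⁻¹ else
      (levelInv (hs n) - u⁻¹) / (hs n u - 1)) atTop (𝓝 (u * u * D)⁻¹) := by
  have hg := tendsto_levelInv hconv hu (h1 ▸ hlim)
  have hv : Tendsto (fun n => (levelInv (hs n))⁻¹) atTop (𝓝 u) := by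
    simpa using hg.inv₀ (inv_pos.2 hu).ne'
  have hS := tendsto_secant_of_convexOn (fun n => (hconv n).convexOn) hu hD hδ0 hδu hδ hlim
    hlim_add hlim_sub hv
  -- The ratio equals `1 / (v u S)`, with `v` the level point and `S` the secant slope.
  refine (((hv.mul_const u).mul hS).inv₀ (by positivity)).congr' ?_
  filter_upwards [hg.eventually (lt_mem_nhds (inv_pos.2 hu))] with n hn
  have happ := (hconv n).apply_inv_levelInv hn
  by_cases hnu : hs n u = 1
  · simp [hnu, (hconv n).levelInv_eq hu hnu]
  · have hne : (levelInv (hs n))⁻¹ ≠ u := fun heq => hnu (heq ▸ happ)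
    rw [if_neg hnu, if_neg hne, slope_def_field, happ]
    have e1 : hs n u - 1 ≠ 0 := sub_ne_zero.2 hnu
    have e2 : 1 - hs n u ≠ 0 := sub_ne_zero.2 (Ne.symm hnu)
    have e3 : (levelInv (hs n))⁻¹ - u ≠ 0 := sub_ne_zero.2 hne
    have e4 : 1 - levelInv (hs n) * u ≠ 0 := by
      intro e
      apply e3
      field_simp
      linarith
    field_simp
    ring

/-! ### Orlicz functions and their sample averages. -/

lemma ContinuousOn.continuous_comp_norm {E : Type*} [NormedAddCommGroup E] {f : ℝ → ℝ}
    (hf : ContinuousOn f (Ici 0)) {u : ℝ} (hu : 0 ≤ u) : Continuous fun x : E => f (‖x‖ * u) :=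
  hf.comp_continuous (by fun_prop) fun x => mem_Ici.2 (by positivity)

namespace IsOrliczFunction

variable {ψ : ℝ → ℝ}

lemma nonneg (hψ : IsOrliczFunction ψ) {x : ℝ} (hx : 0 ≤ x) : 0 ≤ ψ x := by
  have := hψ.monotoneOn (mem_Ici.2 le_rfl) (mem_Ici.2 hx) hx
  rwa [hψ.map_zero] at this

lemma derivWithin_nonneg (hψ : IsOrliczFunction ψ) {x : ℝ} : 0 ≤ derivWithin ψ (Ici 0) x :=
  hψ.monotoneOn.derivWithin_nonneg

lemma monotoneOn_derivWithin (hψ : IsOrliczFunction ψ) (hC : ContDiffOn ℝ 1 ψ (Ici 0)) :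
    MonotoneOn (derivWithin ψ (Ici 0)) (Ici 0) :=
  hψ.convexOn.monotoneOn_derivWithin (hC.differentiableOn one_ne_zero)

lemma continuousOn_derivWithin (hC : ContDiffOn ℝ 1 ψ (Ici 0)) :
    ContinuousOn (derivWithin ψ (Ici 0)) (Ici 0) :=
  hC.continuousOn_derivWithin (uniqueDiffOn_Ici 0) le_rfl

lemma hasDerivAt (hC : ContDiffOn ℝ 1 ψ (Ici 0)) {x : ℝ} (hx : 0 < x) :
    HasDerivAt ψ (derivWithin ψ (Ici 0) x) x :=
  ((hC.differentiableOn one_ne_zero) x (mem_Ici.2 hx.le)).hasDerivWithinAt.hasDerivAt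
    (Ici_mem_nhds hx)

lemma le_mul_derivWithin (hψ : IsOrliczFunction ψ) (hC : ContDiffOn ℝ 1 ψ (Ici 0)) {x : ℝ}
    (hx : 0 ≤ x) : ψ x ≤ x * derivWithin ψ (Ici 0) x := by
  rcases hx.eq_or_lt with rfl | hx
  · simp [hψ.map_zero]
  have := hψ.convexOn.slope_le_derivWithin (mem_Ici.2 le_rfl) (mem_Ici.2 hx.le) hx
    ((hC.differentiableOn one_ne_zero) x (mem_Ici.2 hx.le))
  rw [slope_def_field, hψ.map_zero, sub_zero, sub_zero, div_le_iff₀ hx] at this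
  linarith

lemma derivWithin_le (hψ : IsOrliczFunction ψ) (hC : ContDiffOn ℝ 1 ψ (Ici 0)) {x : ℝ}
    (hx : 0 ≤ x) : derivWithin ψ (Ici 0) x ≤ ψ (x + 1) := by
  have := hψ.convexOn.derivWithin_le_slope (mem_Ici.2 hx) (mem_Ici.2 (by linarith : 0 ≤ x + 1))
    (lt_add_one x) ((hC.differentiableOn one_ne_zero) x (mem_Ici.2 hx))
  rw [slope_def_field, add_sub_cancel_left, div_one] at this
  linarith [hψ.nonneg hx]

/-- An Orlicz function grows at least linearly. -/
lemma exists_le_mul (hψ : IsOrliczFunction ψ) : ∃ A > 0, ∀ x ≥ 0, x ≤ A * (ψ x + 1) := by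
  obtain ⟨a, ha1, ha0⟩ :=
    ((hψ.tendsto_atTop.eventually_ge_atTop 1).and (eventually_gt_atTop 0)).exists
  refine ⟨a, ha0, fun x hx => ?_⟩
  rcases le_or_gt x a with hxa | hxa
  · nlinarith [hψ.nonneg hx]
  have := hψ.convexOn.2 (mem_Ici.2 le_rfl) (mem_Ici.2 hx)
    (sub_nonneg.2 ((div_le_one (ha0.trans hxa)).2 hxa.le)) (div_nonneg ha0.le hx) (by ring)
  simp only [smul_eq_mul, mul_zero, zero_add, hψ.map_zero,
    div_mul_cancel₀ _ (ha0.trans hxa).ne'] at this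
  have h2 : x * 1 ≤ x * (a / x * ψ x) := by gcongr; exact ha1.trans this
  have h3 : x * (a / x * ψ x) = a * ψ x := by
    have := (ha0.trans hxa).ne'
    field_simp
  nlinarith

lemma isConvexGrowth_average (hψ : IsOrliczFunction ψ) (hc : ContinuousOn ψ (Ici 0))
    {E : Type*} [NormedAddCommGroup E] {n : ℕ} (x : Fin n → E) :
    IsConvexGrowth fun u => (1 / (n : ℝ)) * ∑ i, ψ (‖x i‖ * u) where
  monotoneOn u hu v hv huv := by
    rw [mem_Ici] at hu hv
    have (i : Fin n) : ψ (‖x i‖ * u) ≤ ψ (‖x i‖ * v) :=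
      hψ.monotoneOn (mem_Ici.2 (by positivity)) (mem_Ici.2 (by positivity)) (by gcongr)
    dsimp only
    gcongr with i
    exact this i
  convexOn := by
    refine ⟨convex_Ici 0, fun u hu v hv a b ha hb hab => ?_⟩
    rw [mem_Ici] at hu hv
    have (i : Fin n) : ψ (‖x i‖ * (a • u + b • v)) ≤ a * ψ (‖x i‖ * u) + b * ψ (‖x i‖ * v) := by
      have := hψ.convexOn.2 (mem_Ici.2 (by positivity : 0 ≤ ‖x i‖ * u))
        (mem_Ici.2 (by positivity : 0 ≤ ‖x i‖ * v)) ha hb hab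
      simp only [smul_eq_mul] at this ⊢
      rwa [show ‖x i‖ * (a * u + b * v) = a * (‖x i‖ * u) + b * (‖x i‖ * v) by ring]
    calc (1 / (n : ℝ)) * ∑ i, ψ (‖x i‖ * (a • u + b • v))
        ≤ (1 / (n : ℝ)) * ∑ i, (a * ψ (‖x i‖ * u) + b * ψ (‖x i‖ * v)) := by
          gcongr with i
          exact this i
      _ = _ := by
          rw [Finset.sum_add_distrib, ← Finset.mul_sum, ← Finset.mul_sum]
          simp only [smul_eq_mul]
          ring
  continuousOn := by
    refine continuousOn_const.mul (continuousOn_finsetSum _ fun i _ => ?_)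
    refine hc.comp (by fun_prop) fun u hu => ?_
    rw [mem_Ici] at hu ⊢
    positivity
  map_zero := by simp [hψ.map_zero]

end IsOrliczFunction

/-! ### Measurability of the empirical norm. -/

lemma empiricalOrliczNorm_eq_levelInv {E : Type*} [NormedAddCommGroup E] (ψ : ℝ → ℝ) {n : ℕ}
    (x : Fin n → E) :
    empiricalOrliczNorm ψ x = levelInv fun u => (1 / (n : ℝ)) * ∑ i, ψ (‖x i‖ * u) := by
  simp only [empiricalOrliczNorm, levelInv, div_eq_mul_inv]

/-- Real samples suffice because only the norms of the sample enter; this avoids measurability on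
powers of a possibly nonseparable `E`. -/
lemma measurable_empiricalOrliczNorm_real {ψ : ℝ → ℝ} (hψ : IsOrliczFunction ψ)
    (hc : ContinuousOn ψ (Ici 0)) (n : ℕ) :
    Measurable fun x : Fin n → ℝ => empiricalOrliczNorm ψ x := by
  have hpos {s : ℝ} (hs : 0 < s) : MeasurableSet {x : Fin n → ℝ | empiricalOrliczNorm ψ x ≤ s} := by
    simp only [empiricalOrliczNorm_eq_levelInv,
      (hψ.isConvexGrowth_average hc _).levelInv_le_iff hs]
    refine (isClosed_le ?_ continuous_const).measurableSet
    refine continuous_const.mul (continuous_finsetSum _ fun i _ => ?_)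
    exact (hc.continuous_comp_norm (E := ℝ) (inv_nonneg.2 hs.le)).comp (continuous_apply i)
  refine measurable_of_Iic fun s => ?_
  rcases lt_or_ge s 0 with hs | hs
  · convert MeasurableSet.empty
    ext x
    simpa [empiricalOrliczNorm_eq_levelInv] using hs.trans_le (levelInv_nonneg _)
  -- The sublevel description requires a positive level, so `s = 0` is reached from above.
  · have : (fun x : Fin n → ℝ => empiricalOrliczNorm ψ x) ⁻¹' Iic s =
        ⋂ k : ℕ, {x | empiricalOrliczNorm ψ x ≤ s + 1 / ((k : ℝ) + 1)} := by
      ext x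
      simp only [mem_preimage, mem_Iic, mem_iInter, mem_ofPred_eq]
      refine ⟨fun h k => h.trans (by simp; positivity), fun h => ?_⟩
      refine ge_of_tendsto' (x := atTop) ?_ h
      simpa using (tendsto_one_div_add_atTop_nhds_zero_nat (𝕜 := ℝ)).const_add s
    rw [this]
    exact MeasurableSet.iInter fun k => hpos (by positivity)

lemma aemeasurable_empiricalOrliczNorm {E Ω : Type*} [NormedAddCommGroup E] [MeasurableSpace E]
    [OpensMeasurableSpace E] [MeasurableSpace Ω] {P : Measure Ω} {ψ : ℝ → ℝ}
    (hψ : IsOrliczFunction ψ) (hc : ContinuousOn ψ (Ici 0)) {n : ℕ} {x : Fin n → Ω → E}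
    (hx : ∀ i, AEMeasurable (x i) P) :
    AEMeasurable (fun ω => empiricalOrliczNorm ψ fun i => x i ω) P := by
  have : AEMeasurable (fun ω => empiricalOrliczNorm ψ fun i => ‖x i ω‖) P :=
    (measurable_empiricalOrliczNorm_real hψ hc n).comp_aemeasurable
      (aemeasurable_pi_lambda _ fun i => (hx i).norm)
  simpa only [empiricalOrliczNorm, norm_norm] using this

/-! ### Differentiating the expected constraint. -/

section Expectation

variable {Ω E : Type*} [NormedAddCommGroup E] [MeasurableSpace E] [OpensMeasurableSpace E]
  [MeasurableSpace Ω] {P : Measure Ω} {ψ : ℝ → ℝ} {X : Ω → E}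

lemma aestronglyMeasurable_comp_norm {f : ℝ → ℝ} (hf : ContinuousOn f (Ici 0))
    (hX : AEMeasurable X P) {u : ℝ} (hu : 0 ≤ u) :
    AEStronglyMeasurable (fun ω => f (‖X ω‖ * u)) P :=
  ((hf.continuous_comp_norm hu).measurable.comp_aemeasurable hX).aestronglyMeasurable

/-- Convexity gives `ψ y ≤ y ψ' y`, so condition (ii) dominates `ψ` itself. -/
lemma IsOrliczFunction.integrable_comp (hψ : IsOrliczFunction ψ) (hC : ContDiffOn ℝ 1 ψ (Ici 0))
    (hX : AEMeasurable X P) {u b : ℝ} (hu : 0 ≤ u) (hub : u ≤ b)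
    (hb : Integrable (fun ω => ‖X ω‖ * derivWithin ψ (Ici 0) (‖X ω‖ * b)) P) :
    Integrable (fun ω => ψ (‖X ω‖ * u)) P := by
  refine (hb.const_mul b).mono' (aestronglyMeasurable_comp_norm hC.continuousOn hX hu)
    (.of_forall fun ω => ?_)
  have hb0 := hu.trans hub
  rw [Real.norm_of_nonneg (hψ.nonneg (by positivity))]
  calc ψ (‖X ω‖ * u) ≤ ψ (‖X ω‖ * b) :=
        hψ.monotoneOn (mem_Ici.2 (by positivity)) (mem_Ici.2 (by positivity)) (by gcongr)
    _ ≤ ‖X ω‖ * b * derivWithin ψ (Ici 0) (‖X ω‖ * b) :=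
        hψ.le_mul_derivWithin hC (by positivity)
    _ = b * (‖X ω‖ * derivWithin ψ (Ici 0) (‖X ω‖ * b)) := by ring

/-- As `ψ'` is nondecreasing, the integrand at `b > u` dominates all derivatives on `(0, b)`: this
is why (ii) is required at some `σ < σ_ψ`. -/
lemma IsOrliczFunction.hasDerivAt_integral (hψ : IsOrliczFunction ψ)
    (hC : ContDiffOn ℝ 1 ψ (Ici 0)) (hX : AEMeasurable X P) {u b : ℝ} (hu : 0 < u) (hub : u < b)
    (hb : Integrable (fun ω => ‖X ω‖ * derivWithin ψ (Ici 0) (‖X ω‖ * b)) P) :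
    Integrable (fun ω => ‖X ω‖ * derivWithin ψ (Ici 0) (‖X ω‖ * u)) P ∧
      HasDerivAt (fun v => ∫ ω, ψ (‖X ω‖ * v) ∂P)
        (∫ ω, ‖X ω‖ * derivWithin ψ (Ici 0) (‖X ω‖ * u) ∂P) u := by
  refine hasDerivAt_integral_of_dominated_loc_of_deriv_le (s := Ioo 0 b)
    (F' := fun v ω => ‖X ω‖ * derivWithin ψ (Ici 0) (‖X ω‖ * v)) (Ioo_mem_nhds hu hub) ?_
    (hψ.integrable_comp hC hX hu.le hub.le hb) ?_ ?_ hb ?_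
  · filter_upwards [lt_mem_nhds hu] with v hv
    exact aestronglyMeasurable_comp_norm hC.continuousOn hX hv.le
  · exact hX.norm.aestronglyMeasurable.mul
      (aestronglyMeasurable_comp_norm (continuousOn_derivWithin hC) hX hu.le)
  · refine .of_forall fun ω v hv => ?_
    have hv0 := hv.1
    have hb0 := hu.trans hub
    rw [Real.norm_of_nonneg (mul_nonneg (norm_nonneg _) hψ.derivWithin_nonneg)]
    gcongr
    exact hψ.monotoneOn_derivWithin hC (mem_Ici.2 (by positivity)) (mem_Ici.2 (by positivity))
      (by gcongr; exact hv.2.le)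
  · refine .of_forall fun ω v hv => ?_
    rcases (norm_nonneg (X ω)).eq_or_lt with h0 | h0
    · simpa [← h0] using hasDerivAt_const v (ψ 0)
    · have h1 := hasDerivAt hC (mul_pos h0 hv.1)
      have h2 : HasDerivAt (fun v => ‖X ω‖ * v) ‖X ω‖ v := by
        simpa using (hasDerivAt_id v).const_mul ‖X ω‖
      exact (h1.comp v h2).congr_deriv (mul_comm _ _)

/-- The constraint defining the Orlicz norm is attained with equality. -/
lemma IsOrliczFunction.integral_inv_orliczNorm (hψ : IsOrliczFunction ψ)
    (hC : ContDiffOn ℝ 1 ψ (Ici 0)) (hX : AEMeasurable X P) {b : ℝ}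
    (h0 : 0 < orliczNorm ψ X P) (hub : (orliczNorm ψ X P)⁻¹ < b)
    (hb : Integrable (fun ω => ‖X ω‖ * derivWithin ψ (Ici 0) (‖X ω‖ * b)) P) :
    ∫ ω, ψ (‖X ω‖ * (orliczNorm ψ X P)⁻¹) ∂P = 1 := by
  set s := orliczNorm ψ X P with hs
  have hu := inv_pos.2 h0
  have hcont := (hψ.hasDerivAt_integral hC hX hu hub hb).2.continuousAt
  have hiff {v : ℝ} (hv : 0 < v) (hvb : v ≤ b) : (∫ ω, ψ (‖X ω‖ * v) ∂P ≤ 1) ↔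
      v⁻¹ ∈ {σ : ℝ | 0 < σ ∧ ∫⁻ ω, ENNReal.ofReal (ψ (‖X ω‖ / σ)) ∂P ≤ 1} := by
    have hI := hψ.integrable_comp hC hX hv.le hvb hb
    have hnn : 0 ≤ᵐ[P] fun ω => ψ (‖X ω‖ * v) :=
      .of_forall fun ω => hψ.nonneg (by positivity)
    simp only [mem_ofPred_eq, inv_pos, hv, true_and, div_inv_eq_mul]
    rw [← ofReal_integral_eq_lintegral_ofReal hI hnn, ENNReal.ofReal_le_one]
  -- Points left of `s⁻¹` correspond to admissible `σ > s`, points right of it to inadmissible `σ <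
  -- s`; continuity carries both inequalities to `s⁻¹`.
  apply le_antisymm
  · refine le_of_tendsto (hcont.mono_left nhdsWithin_le_nhds : Tendsto _ (𝓝[<] s⁻¹) _) ?_
    filter_upwards [Ioo_mem_nhdsLT hu] with v hv
    have hsv : s < v⁻¹ := (lt_inv_comm₀ h0 hv.1).2 hv.2
    -- An empty set would have infimum `0`, contradicting positivity of the norm.
    have hne : {σ : ℝ | 0 < σ ∧ ∫⁻ ω, ENNReal.ofReal (ψ (‖X ω‖ / σ)) ∂P ≤ 1}.Nonempty := by
      by_contra hne
      rw [hs, orliczNorm, not_nonempty_iff_eq_empty.1 hne, Real.sInf_empty] at h0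
      exact h0.false
    obtain ⟨τ, ⟨hτ, hτ1⟩, hτv⟩ := exists_lt_of_csInf_lt hne hsv
    refine (hiff hv.1 (hv.2.trans hub).le).2 ⟨inv_pos.2 hv.1, le_trans ?_ hτ1⟩
    have hv0 := hv.1
    refine lintegral_mono fun ω => ENNReal.ofReal_le_ofReal (hψ.monotoneOn ?_ ?_ ?_)
    · exact mem_Ici.2 (by positivity)
    · exact mem_Ici.2 (by positivity)
    · gcongr
  · refine ge_of_tendsto (hcont.mono_left nhdsWithin_le_nhds : Tendsto _ (𝓝[>] s⁻¹) _) ?_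
    filter_upwards [Ioo_mem_nhdsGT hub] with v hv
    have hv0 : 0 < v := hu.trans hv.1
    by_contra! hle
    refine notMem_of_lt_csInf ?_ ⟨0, fun _ hx => hx.1.le⟩ ((hiff hv0 hv.2.le).1 hle.le)
    exact (inv_lt_comm₀ h0 hv0).1 hv.1

end Expectation

/-! ### Law of large numbers, central limit theorem and Slutsky's lemma. -/

section IID

variable {Ω E : Type*} [NormedAddCommGroup E] [MeasurableSpace E] [OpensMeasurableSpace E]
  [MeasurableSpace Ω] {P : Measure Ω} {ψ : ℝ → ℝ} {X : Ω → E} {Xs : ℕ → Ω → E}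

lemma ae_tendsto_average (hc : ContinuousOn ψ (Ici 0)) (h_indep : iIndepFun Xs P)
    (h_ident : ∀ i, IdentDistrib (Xs i) X P P) {v : ℝ} (hv : 0 ≤ v)
    (hint : Integrable (fun ω => ψ (‖X ω‖ * v)) P) :
    ∀ᵐ ω ∂P, Tendsto (fun n : ℕ => (1 / (n : ℝ)) * ∑ i : Fin n, ψ (‖Xs i ω‖ * v)) atTop
      (𝓝 (∫ ω, ψ (‖X ω‖ * v) ∂P)) := by
  have hm : Measurable fun x : E => ψ (‖x‖ * v) := (hc.continuous_comp_norm hv).measurable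
  have hid (i : ℕ) : IdentDistrib (fun ω => ψ (‖Xs i ω‖ * v)) (fun ω => ψ (‖X ω‖ * v)) P P :=
    (h_ident i).comp hm
  have := strong_law_ae_real (fun i ω => ψ (‖Xs i ω‖ * v)) ((hid 0).integrable_iff.2 hint)
    (fun i j hij => (h_indep.comp (fun _ x => ψ (‖x‖ * v)) fun _ => hm).indepFun hij)
    (fun i => (hid i).trans (hid 0).symm)
  rw [(hid 0).integral_eq] at this
  filter_upwards [this] with ω hω
  refine hω.congr fun n => ?_
  rw [Finset.sum_range, div_eq_inv_mul, one_div]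

lemma integral_sq_ge_one [IsProbabilityMeasure P] {W : Ω → ℝ}
    (hW2 : MemLp W 2 P) (h1 : ∫ ω, W ω ∂P = 1) :
    1 ≤ ∫ ω, W ω ^ 2 ∂P ∧ Var[W; P] = ∫ ω, W ω ^ 2 ∂P - 1 := by
  have := variance_eq_sub hW2
  have h0 := variance_nonneg W P
  simp only [h1, one_pow, Pi.pow_apply] at this
  exact ⟨by linarith, this⟩

/-- The error of the empirical Orlicz norm, relative to the error of the empirical mean of
`ψ (‖X‖ / σ)` at the Orlicz norm `σ`, converges almost surely. -/
lemma ae_tendsto_levelInv_ratio (hψ : IsOrliczFunction ψ) (hC : ContDiffOn ℝ 1 ψ (Ici 0))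
    (h_indep : iIndepFun Xs P) (h_ident : ∀ i, IdentDistrib (Xs i) X P P) {u b D : ℝ}
    (hu : 0 < u) (hub : u < b)
    (hb : Integrable (fun ω => ‖X ω‖ * derivWithin ψ (Ici 0) (‖X ω‖ * b)) P)
    (hD : D = ∫ ω, ‖X ω‖ * derivWithin ψ (Ici 0) (‖X ω‖ * u) ∂P) (hD0 : D ≠ 0)
    (h1 : ∫ ω, ψ (‖X ω‖ * u) ∂P = 1) :
    ∀ᵐ ω ∂P, Tendsto (fun n : ℕ =>
      if (1 / (n : ℝ)) * ∑ i : Fin n, ψ (‖Xs i ω‖ * u) = 1 then (u * u * D)⁻¹ else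
        (empiricalOrliczNorm ψ (fun i : Fin n => Xs i ω) - u⁻¹) /
          ((1 / (n : ℝ)) * ∑ i : Fin n, ψ (‖Xs i ω‖ * u) - 1)) atTop (𝓝 (u * u * D)⁻¹) := by
  have hX : AEMeasurable X P := (h_ident 0).aemeasurable_snd
  have hlln {v : ℝ} (hv : 0 ≤ v) (hvb : v ≤ b) :=
    ae_tendsto_average hC.continuousOn h_indep h_ident hv (hψ.integrable_comp hC hX hv hvb hb)
  -- This choice keeps every `u ± δ k` in `(0, b]`, where integrability is known; the `+ 2` makes `δ
  -- k < c` strict also at `k = 0`.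
  set c := min u (b - u) with hc
  have hc0 : 0 < c := lt_min hu (sub_pos.2 hub)
  set δ : ℕ → ℝ := fun k => c / ((k : ℝ) + 2) with hδ
  have hδ0 (k : ℕ) : 0 < δ k := by positivity
  have hδc (k : ℕ) : δ k < c := div_lt_self hc0 (by linarith [(Nat.cast_nonneg k : (0 : ℝ) ≤ k)])
  have hδu (k : ℕ) : δ k < u := (hδc k).trans_le (min_le_left _ _)
  have hδb (k : ℕ) : u + δ k ≤ b := by linarith [(hδc k).trans_le (min_le_right u (b - u))]
  have hδlim : Tendsto δ atTop (𝓝 0) :=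
    tendsto_const_nhds.div_atTop (tendsto_natCast_atTop_atTop.atTop_add tendsto_const_nhds)
  have hadd := ae_all_iff.2 fun k => hlln (add_pos hu (hδ0 k)).le (hδb k)
  have hsub := ae_all_iff.2 fun k => hlln (sub_nonneg.2 (hδu k).le)
    ((sub_lt_self u (hδ0 k)).le.trans hub.le)
  filter_upwards [hlln hu.le hub.le, hadd, hsub] with ω hω hω_add hω_sub
  simp only [empiricalOrliczNorm_eq_levelInv]
  exact tendsto_levelInv_ratio
    (hs := fun (n : ℕ) u => (1 / (n : ℝ)) * ∑ i : Fin n, ψ (‖Xs i ω‖ * u))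
    (h := fun v => ∫ ω, ψ (‖X ω‖ * v) ∂P)
    (fun n => hψ.isConvexGrowth_average hC.continuousOn fun i : Fin n => Xs i ω) hu hD0
    (hD ▸ (hψ.hasDerivAt_integral hC hX hu hub hb).2) h1 hδ0 hδu hδlim hω hω_add hω_sub

/-- Asymptotic normality of the empirical Orlicz norm around a point `u⁻¹` at which the constraint
defining the Orlicz norm is an equality. -/
lemma tendstoInDistribution_empiricalOrliczNorm [IsProbabilityMeasure P]
    (hψ : IsOrliczFunction ψ) (hC : ContDiffOn ℝ 1 ψ (Ici 0))
    (h_indep : iIndepFun Xs P) (h_ident : ∀ i, IdentDistrib (Xs i) X P P) {u b K : ℝ}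
    (hu : 0 < u) (hub : u < b)
    (hb : Integrable (fun ω => ‖X ω‖ * derivWithin ψ (Ici 0) (‖X ω‖ * b)) P)
    (hK : K = u * u * ∫ ω, ‖X ω‖ * derivWithin ψ (Ici 0) (‖X ω‖ * u) ∂P) (hK0 : K ≠ 0)
    (h1 : ∫ ω, ψ (‖X ω‖ * u) ∂P = 1) (h2 : MemLp (fun ω => ψ (‖X ω‖ * u)) 2 P) :
    TendstoInDistribution
      (fun (n : ℕ) (ω : Ω) =>
        √(n : ℝ) * (empiricalOrliczNorm ψ (fun i : Fin n => Xs i ω) - u⁻¹))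
      atTop (fun z : ℝ => z) (fun _ => P)
      (gaussianReal 0 (Real.toNNReal ((∫ ω, ψ (‖X ω‖ * u) ^ 2 ∂P - 1) / K ^ 2))) := by
  have hc := hC.continuousOn
  have hm : Measurable fun x : E => ψ (‖x‖ * u) := (hc.continuous_comp_norm hu.le).measurable
  set W : ℕ → Ω → ℝ := fun i ω => ψ (‖Xs i ω‖ * u) with hW
  have hid (i : ℕ) : IdentDistrib (W i) (fun ω => ψ (‖X ω‖ * u)) P P := (h_ident i).comp hm
  have hWm (i : ℕ) : AEMeasurable (W i) P := (hid i).aemeasurable_fst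
  set V := ∫ ω, ψ (‖X ω‖ * u) ^ 2 ∂P - 1 with hV
  have hvar : Var[W 0; P] = V := (hid 0).variance_eq.trans (integral_sq_ge_one h2 h1).2
  have hmean : P[W 0] = 1 := (hid 0).integral_eq.trans h1
  set Q := gaussianReal 0 (Real.toNNReal (V / K ^ 2)) with hQ
  -- Realizing the limit of the central limit theorem as `K * z` with `z` of law `Q` lets the factor
  -- `K⁻¹` from Slutsky's lemma return exactly `z`. A zero variance is included.
  have hlaw : HasLaw (fun z : ℝ => K * z) (gaussianReal 0 Var[W 0; P].toNNReal) Q := by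
    have := gaussianReal_const_mul (HasLaw.id (μ := Q)) K
    have hV0 : 0 ≤ V := hvar ▸ variance_nonneg _ _
    simp only [mul_zero, id] at this
    convert this using 2
    · apply NNReal.coe_injective
      rw [hvar, NNReal.coe_mul, Real.coe_toNNReal _ hV0, Real.coe_toNNReal _ (by positivity)]
      simp only [NNReal.coe_mk]
      field_simp
  have hclt := tendstoInDistribution_inv_sqrt_mul_sum_sub hlaw ((hid 0).memLp_iff.2 h2)
    (h_indep.comp (fun _ x => ψ (‖x‖ * u)) fun _ => hm) (fun i => (hid i).trans (hid 0).symm)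
  -- When the average is exactly `1`, both errors vanish, so the default `K⁻¹` preserves the product
  -- and the limit.
  set R : ℕ → Ω → ℝ := fun n ω => if (1 / (n : ℝ)) * ∑ i : Fin n, W i ω = 1 then K⁻¹ else
    (empiricalOrliczNorm ψ (fun i : Fin n => Xs i ω) - u⁻¹) /
      ((1 / (n : ℝ)) * ∑ i : Fin n, W i ω - 1) with hR
  have hRlim : ∀ᵐ ω ∂P, Tendsto (fun n => R n ω) atTop (𝓝 K⁻¹) := by
    simp only [hR, hK]
    exact ae_tendsto_levelInv_ratio hψ hC h_indep h_ident hu hub hb rfl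
      (right_ne_zero_of_mul (hK ▸ hK0)) h1
  have hRm (n : ℕ) : AEMeasurable (R n) P := by
    have hA : AEMeasurable (fun ω => (1 / (n : ℝ)) * ∑ i : Fin n, W i ω) P :=
      (Finset.aemeasurable_fun_sum Finset.univ fun (i : Fin n) _ => hWm i).const_mul _
    have hB : AEMeasurable (fun ω => empiricalOrliczNorm ψ fun i : Fin n => Xs i ω) P :=
      aemeasurable_empiricalOrliczNorm hψ hc fun i => (h_ident i).aemeasurable_fst
    have hG : Measurable fun p : ℝ × ℝ => if p.1 = 1 then K⁻¹ else (p.2 - u⁻¹) / (p.1 - 1) :=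
      Measurable.ite (measurableSet_eq_fun measurable_fst measurable_const) measurable_const
        ((measurable_snd.sub_const _).div (measurable_fst.sub_const _))
    exact hG.comp_aemeasurable (hA.prodMk hB)
  have hslutsky := hclt.continuous_comp_prodMk_of_tendstoInMeasure_const
    (g := fun p : ℝ × ℝ => p.1 * p.2) continuous_mul
    (tendstoInMeasure_of_tendsto_ae (fun n => (hRm n).aestronglyMeasurable) hRlim) hRm
  refine hslutsky.congr (fun n => .of_forall fun ω => ?_) (.of_forall fun z => ?_)
  · rcases n.eq_zero_or_pos with rfl | hn
    · simp
    have hn' : (0 : ℝ) < n := Nat.cast_pos.2 hn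
    have hZ : (√(n : ℝ))⁻¹ * (∑ k ∈ Finset.range n, W k ω - n * P[W 0]) =
        √(n : ℝ) * ((1 / (n : ℝ)) * ∑ i : Fin n, W i ω - 1) := by
      rw [hmean, Finset.sum_range]
      have hs : √(n : ℝ) ≠ 0 := (Real.sqrt_pos.2 hn').ne'
      field_simp
      rw [Real.sq_sqrt hn'.le]
    change (√(n : ℝ))⁻¹ * (∑ k ∈ Finset.range n, W k ω - n * P[W 0]) * R n ω = _
    rw [hZ, mul_assoc]
    congr 1
    simp only [hR]
    split_ifs with h
    · have := (hψ.isConvexGrowth_average hc fun i : Fin n => Xs i ω).levelInv_eq hu h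
      rw [h, empiricalOrliczNorm_eq_levelInv, this]
      simp
    · exact mul_div_cancel₀ _ (sub_ne_zero.2 h)
  · field_simp

end IID

/-! ### The sufficient moment condition and the final assembly. -/

/-- For (ii), `ψ' x ≤ ψ (x + 1)` by the unit secant and `x ≤ A (ψ (x + 1) + 1)` by linear growth, so
`x ψ' x` is at most quadratic in `ψ (x + 1)`. -/
lemma IsOrliczFunction.integrable_of_integrable_add_one_sq {Ω E : Type*} [NormedAddCommGroup E]
    [MeasurableSpace E] [OpensMeasurableSpace E] [MeasurableSpace Ω] {P : Measure Ω}
    [IsProbabilityMeasure P] {ψ : ℝ → ℝ} (hψ : IsOrliczFunction ψ)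
    (hC : ContDiffOn ℝ 1 ψ (Ici 0)) {X : Ω → E} (hX : AEMeasurable X P) {σ : ℝ} (hσ : 0 < σ)
    (hI : Integrable (fun ω => ψ (‖X ω‖ / σ + 1) ^ 2) P) :
    (∀ s, σ ≤ s → Integrable (fun ω => ψ (‖X ω‖ / s) ^ 2) P) ∧
      Integrable (fun ω => ‖X ω‖ * derivWithin ψ (Ici 0) (‖X ω‖ / σ)) P := by
  constructor
  · intro s hs
    have hs0 : 0 < s := hσ.trans_le hs
    have hm := aestronglyMeasurable_comp_norm hC.continuousOn hX (inv_nonneg.2 hs0.le)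
    simp only [← div_eq_mul_inv] at hm
    refine hI.mono' (hm.pow 2) (.of_forall fun ω => ?_)
    rw [Real.norm_of_nonneg (sq_nonneg _)]
    have hle : ‖X ω‖ / s ≤ ‖X ω‖ / σ + 1 := by
      have : ‖X ω‖ / s ≤ ‖X ω‖ / σ := by gcongr
      linarith
    have h0 : 0 ≤ ψ (‖X ω‖ / s) := hψ.nonneg (by positivity)
    gcongr
    exact hψ.monotoneOn (mem_Ici.2 (by positivity)) (mem_Ici.2 (by positivity)) hle
  · obtain ⟨A, hA, hlin⟩ := hψ.exists_le_mul
    have hm := aestronglyMeasurable_comp_norm (continuousOn_derivWithin hC) hX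
      (inv_nonneg.2 hσ.le)
    refine ((hI.const_mul (2 * σ * A)).add (integrable_const (2 * σ * A))).mono'
      (hX.norm.aestronglyMeasurable.mul (by simpa only [div_eq_mul_inv] using hm))
      (.of_forall fun ω => ?_)
    rw [Real.norm_of_nonneg (mul_nonneg (norm_nonneg _) hψ.derivWithin_nonneg)]
    set x := ‖X ω‖ / σ with hx
    have hx0 : 0 ≤ x := by positivity
    have hXx : ‖X ω‖ = σ * x := by rw [hx]; field_simp
    have hp0 : 0 ≤ ψ (x + 1) := hψ.nonneg (by linarith)
    have hxle : x ≤ A * (ψ (x + 1) + 1) :=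
      (le_add_of_nonneg_right zero_le_one).trans (hlin (x + 1) (by linarith : (0 : ℝ) ≤ x + 1))
    have hquad : (ψ (x + 1) + 1) * ψ (x + 1) ≤ 2 * ψ (x + 1) ^ 2 + 2 := by
      nlinarith [sq_nonneg (ψ (x + 1) - 1)]
    rw [hXx]
    simp only [Pi.add_apply]
    calc σ * x * derivWithin ψ (Ici 0) x ≤ σ * (A * (ψ (x + 1) + 1)) * ψ (x + 1) := by
          gcongr
          · exact hψ.derivWithin_nonneg
          · exact hψ.derivWithin_le hC hx0
      _ = σ * A * ((ψ (x + 1) + 1) * ψ (x + 1)) := by ring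
      _ ≤ σ * A * (2 * ψ (x + 1) ^ 2 + 2) := by gcongr
      _ = 2 * σ * A * ψ (x + 1) ^ 2 + 2 * σ * A := by ring

theorem theorem4
    {E : Type*} [NormedAddCommGroup E] [NormedSpace ℝ E] [CompleteSpace E]
    [MeasurableSpace E] [BorelSpace E]
    {Ω : Type*} [MeasurableSpace Ω] (P : Measure Ω) [IsProbabilityMeasure P]
    (ψ : ℝ → ℝ) (hψ : IsOrliczFunction ψ) (hψ_C1 : ContDiffOn ℝ 1 ψ (Ici 0))
    (X : Ω → E) (Xs : ℕ → Ω → E)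
    (h_indep : iIndepFun Xs P) (h_ident : ∀ i, IdentDistrib (Xs i) X P P) :
    -- conditions (i) and (ii) imply the central limit theorem
    (Integrable (fun ω => ψ (‖X ω‖ / orliczNorm ψ X P) ^ 2) P →
      (∃ σ : ℝ, 0 < σ ∧ σ < orliczNorm ψ X P ∧
        Integrable (fun ω => ‖X ω‖ * derivWithin ψ (Ici 0) (‖X ω‖ / σ)) P) →
      -- the variance of the limit is a well-defined quotient of nonnegative reals
      1 ≤ ∫ ω, ψ (‖X ω‖ / orliczNorm ψ X P) ^ 2 ∂P ∧
      0 < ∫ ω, ‖X ω‖ / orliczNorm ψ X P ^ 2 *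
            derivWithin ψ (Ici 0) (‖X ω‖ / orliczNorm ψ X P) ∂P ∧
      TendstoInDistribution
        (fun (n : ℕ) (ω : Ω) =>
          √(n : ℝ) * (empiricalOrliczNorm ψ (fun i : Fin n => Xs i ω) - orliczNorm ψ X P))
        atTop (fun z : ℝ => z) (fun _ => P)
        (gaussianReal 0 (Real.toNNReal
          (((∫ ω, ψ (‖X ω‖ / orliczNorm ψ X P) ^ 2 ∂P) - 1) /
            (∫ ω, ‖X ω‖ / orliczNorm ψ X P ^ 2 *
              derivWithin ψ (Ici 0) (‖X ω‖ / orliczNorm ψ X P) ∂P) ^ 2))))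
    ∧
    -- a sufficient condition for (i) and (ii)
    ((∃ σ : ℝ, 0 < σ ∧ σ < orliczNorm ψ X P ∧
        Integrable (fun ω => ψ (‖X ω‖ / σ + 1) ^ 2) P) →
      Integrable (fun ω => ψ (‖X ω‖ / orliczNorm ψ X P) ^ 2) P ∧
      ∃ σ : ℝ, 0 < σ ∧ σ < orliczNorm ψ X P ∧
        Integrable (fun ω => ‖X ω‖ * derivWithin ψ (Ici 0) (‖X ω‖ / σ)) P) := by
  have hX : AEMeasurable X P := (h_ident 0).aemeasurable_snd
  refine ⟨?_, ?_⟩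
  · rintro hsq ⟨σ, hσ, hσs, hd⟩
    set s := orliczNorm ψ X P with hs
    have hs0 : 0 < s := hσ.trans hσs
    have hu := inv_pos.2 hs0
    have hub : s⁻¹ < σ⁻¹ := inv_strictAnti₀ hσ hσs
    simp only [div_eq_mul_inv _ σ] at hd
    have h1 := hψ.integral_inv_orliczNorm hψ_C1 hX hs0 hub hd
    obtain ⟨hDint, -⟩ := hψ.hasDerivAt_integral hψ_C1 hX hu hub hd
    have hm := aestronglyMeasurable_comp_norm hψ_C1.continuousOn hX hu.le
    have h2 : MemLp (fun ω => ψ (‖X ω‖ * s⁻¹)) 2 P :=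
      (memLp_two_iff_integrable_sq hm).2 (by simpa only [div_eq_mul_inv] using hsq)
    have hK : ∫ ω, ‖X ω‖ / s ^ 2 * derivWithin ψ (Ici 0) (‖X ω‖ / s) ∂P =
        s⁻¹ * s⁻¹ * ∫ ω, ‖X ω‖ * derivWithin ψ (Ici 0) (‖X ω‖ * s⁻¹) ∂P := by
      rw [← integral_const_mul]
      refine integral_congr_ae (.of_forall fun ω => ?_)
      simp only [div_eq_mul_inv]
      ring
    have hKpos : 0 < ∫ ω, ‖X ω‖ / s ^ 2 * derivWithin ψ (Ici 0) (‖X ω‖ / s) ∂P := by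
      rw [hK, mul_assoc]
      -- Positivity comes from `1 = E ψ(‖X‖ u) ≤ E[‖X‖ u ψ'(‖X‖ u)]`, where `u = s⁻¹`.
      refine mul_pos hu (zero_lt_one.trans_le ?_)
      rw [← h1, ← integral_const_mul]
      refine integral_mono (hψ.integrable_comp hψ_C1 hX hu.le hub.le hd) (hDint.const_mul _)
        fun ω => ?_
      refine (hψ.le_mul_derivWithin hψ_C1 (by positivity)).trans_eq ?_
      ring
    have hclt := tendstoInDistribution_empiricalOrliczNorm hψ hψ_C1 h_indep h_ident hu hub hd hK
      hKpos.ne' h1 h2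
    refine ⟨?_, hKpos, ?_⟩
    · simpa only [div_eq_mul_inv] using (integral_sq_ge_one h2 h1).1
    · simpa only [div_eq_mul_inv, inv_inv] using hclt
  · rintro ⟨σ, hσ, hσs, hI⟩
    obtain ⟨hi, hii⟩ := hψ.integrable_of_integrable_add_one_sq hψ_C1 hX hσ hI
    exact ⟨hi _ hσs.le, σ, hσ, hσs, hii⟩
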